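/- Let $c,k,m\ge 1$ be integers. Workers are grouped into $c$ clusters; cluster $u\in[c]$ has $n_u\ge 1$ workers, each of which has to compute $\tau_u\ge 1$ tasks, and $n=\sum_u n_u$ (the product of two matrices computed by RPM3 is divided into $km$ smaller products). Under the cluster-dependent additive service time model all task times are independent, and each task of a worker of cluster $u$ takes a shifted exponential time with shift $s_u/(km)$ and rate $\lambda_u km$, i.e. with density $\lambda_u km\,e^{-\lambda_u km(x-s_u/(km))}$ for $x>s_u/(km)$ and $0$ otherwise, where $\lambda_u>0$ and $\lambda_u s_u=t_m$ does not depend on $u$. Cluster $c$ is the slowest: $\lambda_c=\min_u\lambda_u$. Let $T_u^i$ be the time spent by the $i$-th worker of cluster $u$ on its $\tau_u$ tasks (the sum of its task times), and let $T_{RPM3}=\max_{u\in[c]}\max_{i\in[n_u]}T_u^i$ be the waiting time of the master. Put $\tau_{\max}=\max_u\tau_u$ and $s_m=\max_u s_u\tau_u$. 1. Each $T_u^i$ is a shifted Erlang variable with shape $\tau_u$, rate $\lambda_u km$ and shift $\tau_u s_u/(km)$. 2. For every $x\ge s_m/(km)$, $$\Pr(T_{RPM3}>x)\le 1-\Big(1-\sum_{j=0}^{\tau_{\max}-1}\frac{e^{\lambda_c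 s_m-\lambda_c kmx}}{j!}\,(\lambda_c kmx-\lambda_c s_m)^j\Big)^n ,$$ and the inequality is strict if $x>s_m/(km)$ and the clusters do not all have $\lambda_u=\lambda_c$ and $\tau_u=\tau_{\max}$. For $x<s_m/(km)$, $\Pr(T_{RPM3}\le x)=0$. For $x\ge s_m/(km)$ the expression inside the $n$-th power is the distribution function at $x$ of the Erlang law with shape $\tau_{\max}$ and rate $\lambda_c km$ shifted by $s_m/(km)$. 3. $T_{RPM3}$ is integrable and $\mathbb{E}[T_{RPM3}]\le \frac{s_m}{km}+\Phi(n)$, where $$\Phi(n)=\frac{n}{\lambda_c km\,(\tau_{\max}-1)!}\sum_{j=0}^{n-1}(-1)^j\binom{n-1}{j}\sum_{\ell=0}^{(\tau_{\max}-1)j}a_\ell(\tau_{\max},j)\,\frac{(\tau_{\max}+\ell)!}{(j+1)^{\tau_{\max}+\ell+1}}$$ and $a_\ell(\tau_{\max},j)$ is the coefficient of $x^\ell$ in $\Big(\sum_{i=0}^{\tau_{\max}-1}\frac{x^i}{i!}\Big)^j$. Moreover, $\Phi(n)$ is the mean of the maximum of $n$ independent Erlang variables with shape $\tau_{\max}$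 and rate $\lambda_c km$; this maximum is integrable. -/

import Mathlib

open MeasureTheory ProbabilityTheory

noncomputable section

/-- Law of `a + E`, where `E` is exponential with rate `r`: density `r * exp (-r * (x - a))`
for `x > a` and `0` otherwise. -/
def shiftedExp (a r : ℝ) : Measure ℝ :=
  (expMeasure r).map (fun x => x + a)

/-- Erlang law with (positive integer) shape `t` and rate `r`. -/
def erlang (t : ℕ) (r : ℝ) : Measure ℝ :=
  gammaMeasure (t : ℝ) r

/-- Law of `a + E`, where `E` is Erlang with shape `t` and rate `r`. -/
def shiftedErlang (t : ℕ) (a r : ℝ) : Measure ℝ :=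
  (erlang t r).map (fun x => x + a)

/-- Cluster-dependent additive service time. There are `c` clusters, cluster `u` has `n u` workers,
each of which computes `τ u` tasks; `X u i j` is the time spent by worker `i` of cluster `u` on its
`j`-th task. All task times are independent, and those of cluster `u` are shifted exponential with
shift `s u / (k * m)` and rate `lam u * (k * m)`. -/
structure IsAdditiveServiceTime {Ω : Type*} [MeasurableSpace Ω] (P : Measure Ω) (k m : ℕ) {c : ℕ}
    (n τ : Fin c → ℕ) (lam s : Fin c → ℝ)
    (X : (u : Fin c) → Fin (n u) → Fin (τ u) → Ω → ℝ) : Prop where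
  measurable : ∀ u i j, Measurable (X u i j)
  law : ∀ u i j, P.map (X u i j) = shiftedExp (s u / (k * m)) (lam u * (k * m))
  indep : iIndepFun
    (fun a : (u : Fin c) × (Fin (n u) × Fin (τ u)) => X a.1 a.2.1 a.2.2) P

/-- Time spent by worker `i` of cluster `u` to compute its `τ u` tasks. -/
def workerTime {Ω : Type*} {c : ℕ} {n τ : Fin c → ℕ}
    (X : (u : Fin c) → Fin (n u) → Fin (τ u) → Ω → ℝ) (u : Fin c) (i : Fin (n u)) (ω : Ω) : ℝ :=
  ∑ j, X u i j ω

/-- Time until all the workers of cluster `u` have computed their `τ u` tasks. -/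
def clusterTime {Ω : Type*} {c : ℕ} {n τ : Fin c → ℕ}
    (X : (u : Fin c) → Fin (n u) → Fin (τ u) → Ω → ℝ) (u : Fin c) (ω : Ω) : ℝ :=
  ⨆ i, workerTime X u i ω

/-- Waiting time of the master. -/
def waitingTime {Ω : Type*} {c : ℕ} {n τ : Fin c → ℕ}
    (X : (u : Fin c) → Fin (n u) → Fin (τ u) → Ω → ℝ) (ω : Ω) : ℝ :=
  ⨆ u, clusterTime X u ω

/-- Coefficient of `x ^ l` in `(∑_{i < t} x ^ i / i!) ^ j`. -/
def expandCoeff (t j l : ℕ) : ℝ :=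
  ((∑ i ∈ Finset.range t, Polynomial.monomial i (1 / (i.factorial : ℝ))) ^ j).coeff l

/-- The alternating double sum `Φ(N)` for shape `t` and rate `r`. -/
def erlangMaxMean (N t : ℕ) (r : ℝ) : ℝ :=
  (N : ℝ) / (r * ((t - 1).factorial : ℝ)) *
    ∑ j ∈ Finset.range N, (-1 : ℝ) ^ j * ((N - 1).choose j : ℝ) *
      ∑ l ∈ Finset.range ((t - 1) * j + 1),
        expandCoeff t j l * ((t + l).factorial : ℝ) / ((j : ℝ) + 1) ^ (t + l + 1)

end

/-!
The time of a worker is a constant plus a sum of independent exponential times, hence shifted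
Erlang, because gamma laws of equal rate convolve by adding shapes (the beta integral). The
distribution function `1 - e⁻ʸ ∑_{j < t} yʲ / j!` of the Erlang law increases with `y` and decreases
with `t`, so replacing every worker by the slowest conceivable one (largest shape, smallest rate,
largest shift) can only lower the distribution function of the maximum, which is a product. Means
are monotone under this stochastic domination. For `N` equal workers the distribution function is an
`N`-th power; differentiating it and expanding binomially leaves only the moments
`∫ xᵖ e⁻ᵇˣ = p! / bᵖ⁺¹`, which sum up to `Φ(N)`.
-/

section GammaConvolution

lemma gammaPDFReal_of_neg (a r : ℝ) {x : ℝ} (hx : x < 0) : gammaPDFReal a r x = 0 :=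
  if_neg hx.not_ge

@[fun_prop]
lemma measurable_gammaPDF (a r : ℝ) : Measurable (gammaPDF a r) :=
  (measurable_gammaPDFReal a r).ennreal_ofReal

lemma mul_gammaPDFReal_mul_gammaPDFReal {a b r x u : ℝ} (ha : 0 < a) (hb : 0 < b) (hr : 0 < r)
    (hx : 0 < x) (hu₀ : u ≠ 0) (hu₁ : u ≠ 1) :
    x * (gammaPDFReal a r (x * u) * gammaPDFReal b r (x * (1 - u))) =
      gammaPDFReal (a + b) r x * betaPDFReal a b u := by
  rcases hu₀.lt_or_gt with hu | hu
  · rw [gammaPDFReal_of_neg a r (mul_neg_of_pos_of_neg hx hu), betaPDFReal,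
      if_neg fun h => hu.not_gt h.1]
    ring
  rcases hu₁.lt_or_gt with hu' | hu'
  · have hv : 0 < 1 - u := sub_pos.2 hu'
    have hexp : Real.exp (-(r * x)) =
        Real.exp (-(r * (x * u))) * Real.exp (-(r * (x * (1 - u)))) := by
      rw [← Real.exp_add]; congr 1; ring
    have hrpow : x ^ (a + b - 1) = x ^ (a - 1) * x ^ (b - 1) * x := by
      rw [← Real.rpow_add hx, ← Real.rpow_add_one hx.ne']; congr 1; ring
    have := Real.Gamma_pos_of_pos ha
    have := Real.Gamma_pos_of_pos hb
    have := Real.Gamma_pos_of_pos (add_pos ha hb)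
    rw [gammaPDFReal, gammaPDFReal, gammaPDFReal, betaPDFReal, beta, if_pos (by positivity),
      if_pos (by positivity), if_pos hx.le, if_pos ⟨hu, hu'⟩, Real.mul_rpow hx.le hu.le,
      Real.mul_rpow hx.le hv.le, Real.rpow_add hr, hexp, hrpow]
    field_simp
  · rw [gammaPDFReal_of_neg b r (mul_neg_of_pos_of_neg hx (sub_neg.2 hu')), betaPDFReal,
      if_neg fun h => hu'.not_gt h.2]
    ring

lemma lintegral_eq_ofReal_mul_lintegral_comp_mul_left {f : ℝ → ENNReal} (hf : Measurable f)
    {x : ℝ} (hx : 0 < x) : ∫⁻ y, f y = ENNReal.ofReal x * ∫⁻ u, f (x * u) := by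
  conv_lhs => rw [← Real.smul_map_volume_mul_left hx.ne']
  rw [lintegral_smul_measure, lintegral_map hf (by fun_prop), abs_of_pos hx, smul_eq_mul]

/-- Given that two independent gamma variables sum to `x`, the first one is `x` times a beta
variable. -/
lemma lintegral_gammaPDF_mul_gammaPDF {a b r x : ℝ} (ha : 0 < a) (hb : 0 < b) (hr : 0 < r)
    (hx : 0 < x) :
    ∫⁻ y, gammaPDF a r y * gammaPDF b r (-y + x) = gammaPDF (a + b) r x := by
  have hpoint : ∀ᵐ u : ℝ, ENNReal.ofReal x * (gammaPDF a r (x * u) * gammaPDF b r (-(x * u) + x)) =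
      gammaPDF (a + b) r x * betaPDF a b u := by
    filter_upwards [Measure.ae_ne volume 0, Measure.ae_ne volume 1] with u hu₀ hu₁
    rw [gammaPDF, gammaPDF, gammaPDF, betaPDF, ← ENNReal.ofReal_mul (gammaPDFReal_nonneg ha hr _),
      ← ENNReal.ofReal_mul hx.le, ← ENNReal.ofReal_mul (gammaPDFReal_nonneg (by positivity) hr _),
      ← mul_gammaPDFReal_mul_gammaPDFReal ha hb hr hx hu₀ hu₁]
    ring_nf
  rw [lintegral_eq_ofReal_mul_lintegral_comp_mul_left (by fun_prop) hx,
    ← lintegral_const_mul _ (by fun_prop), lintegral_congr_ae hpoint,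
    lintegral_const_mul _ (by unfold betaPDF; fun_prop), lintegral_betaPDF_eq_one ha hb, mul_one]

lemma gammaMeasure_conv_gammaMeasure {a b r : ℝ} (ha : 0 < a) (hb : 0 < b) (hr : 0 < r) :
    (gammaMeasure a r).conv (gammaMeasure b r) = gammaMeasure (a + b) r := by
  rw [gammaMeasure, gammaMeasure, gammaMeasure,
    conv_withDensity_eq_lconvolution (by fun_prop) (by fun_prop)]
  refine withDensity_congr_ae ?_
  filter_upwards [Measure.ae_ne volume 0] with x hx₀
  rw [lconvolution_def]
  rcases hx₀.lt_or_gt with hx | hx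
  · rw [gammaPDF_of_neg hx, lintegral_eq_zero_of_ae_eq_zero]
    refine ae_of_all _ fun y => show gammaPDF a r y * gammaPDF b r (-y + x) = 0 from ?_
    rcases lt_or_ge y 0 with hy | hy
    · rw [gammaPDF_of_neg hy, zero_mul]
    · rw [gammaPDF_of_neg (x := -y + x) (by linarith), mul_zero]
  · exact lintegral_gammaPDF_mul_gammaPDF ha hb hr hx

lemma map_sum_eq_gammaMeasure {Ω ι : Type*} [MeasurableSpace Ω] {P : Measure Ω} {r : ℝ}
    (hr : 0 < r) {a : ι → ℝ} (ha : ∀ i, 0 < a i) {Y : ι → Ω → ℝ} (hY : ∀ i, Measurable (Y i))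
    (hlaw : ∀ i, P.map (Y i) = gammaMeasure (a i) r) (hind : iIndepFun Y P) {S : Finset ι}
    (hS : S.Nonempty) :
    P.map (∑ i ∈ S, Y i) = gammaMeasure (∑ i ∈ S, a i) r := by
  have := hind.isProbabilityMeasure
  induction hS using Finset.Nonempty.cons_induction with
  | singleton i => simp [hlaw]
  | cons i S hi hS ih =>
    rw [Finset.sum_cons, Finset.sum_cons, add_comm, add_comm (a i),
      (hind.indepFun_finsetSum_of_notMem hY hi).map_add_eq_map_conv_map (by fun_prop) (hY i), ih,
      hlaw, gammaMeasure_conv_gammaMeasure (Finset.sum_pos (fun j _ => ha j) hS) (ha i) hr]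

end GammaConvolution

section ErlangCDF

/-- Distribution function at `y ≥ 0` of the Erlang law with shape `t` and rate `1`; its values at
`y < 0` are meaningless. -/
noncomputable def erlangCDF (t : ℕ) (y : ℝ) : ℝ :=
  1 - Real.exp (-y) * ∑ j ∈ Finset.range t, y ^ j / (j.factorial : ℝ)

lemma erlangCDF_succ (d : ℕ) (y : ℝ) :
    erlangCDF (d + 1) y = erlangCDF d y - Real.exp (-y) * (y ^ d / (d.factorial : ℝ)) := by
  rw [erlangCDF, erlangCDF, Finset.sum_range_succ]; ring

lemma erlangCDF_zero_right {t : ℕ} (ht : 0 < t) : erlangCDF t 0 = 0 := by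
  obtain ⟨d, rfl⟩ := Nat.exists_eq_succ_of_ne_zero ht.ne'
  simp [erlangCDF, Finset.sum_range_succ']

lemma hasDerivAt_erlangCDF_succ (d : ℕ) (y : ℝ) :
    HasDerivAt (erlangCDF (d + 1)) (Real.exp (-y) * (y ^ d / (d.factorial : ℝ))) y := by
  have hexp : HasDerivAt (fun y : ℝ => Real.exp (-y)) (-Real.exp (-y)) y := by
    simpa using (hasDerivAt_neg y).exp
  induction d with
  | zero =>
    have hone : erlangCDF (0 + 1) = fun y => 1 - Real.exp (-y) := by
      funext y; simp [erlangCDF]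
    simpa [hone] using hexp.const_sub 1
  | succ d ih =>
    rw [funext (erlangCDF_succ (d + 1))]
    refine (ih.sub (hexp.mul ((hasDerivAt_pow (d + 1) y).div_const _))).congr_deriv ?_
    rw [Nat.factorial_succ]
    push_cast
    field_simp
    simp

lemma continuous_erlangCDF (t : ℕ) : Continuous (erlangCDF t) := by
  unfold erlangCDF; fun_prop

lemma strictMonoOn_erlangCDF {t : ℕ} (ht : 0 < t) : StrictMonoOn (erlangCDF t) (Set.Ici 0) := by
  obtain ⟨d, rfl⟩ := Nat.exists_eq_succ_of_ne_zero ht.ne'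
  refine strictMonoOn_of_deriv_pos (convex_Ici 0) (continuous_erlangCDF _).continuousOn ?_
  intro y hy
  rw [interior_Ici, Set.mem_Ioi] at hy
  rw [(hasDerivAt_erlangCDF_succ d y).deriv]
  positivity

lemma antitone_erlangCDF {y : ℝ} (hy : 0 ≤ y) : Antitone fun t => erlangCDF t y :=
  antitone_nat_of_succ_le fun d => by
    rw [erlangCDF_succ, sub_le_self_iff]
    positivity

lemma strictAnti_erlangCDF {y : ℝ} (hy : 0 < y) : StrictAnti fun t => erlangCDF t y :=
  strictAnti_nat_of_succ_lt fun d => by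
    rw [erlangCDF_succ, sub_lt_self_iff]
    positivity

lemma erlangCDF_le_erlangCDF {t t' : ℕ} (ht : 0 < t) (htt' : t ≤ t') {y y' : ℝ} (hy' : 0 ≤ y')
    (hyy' : y' ≤ y) : erlangCDF t' y' ≤ erlangCDF t y :=
  (antitone_erlangCDF hy' htt').trans
    ((strictMonoOn_erlangCDF ht).monotoneOn hy' (hy'.trans hyy') hyy')

lemma erlangCDF_lt_erlangCDF {t t' : ℕ} (ht : 0 < t) (htt' : t ≤ t') {y y' : ℝ} (hy' : 0 < y')
    (hyy' : y' ≤ y) (hne : y ≠ y' ∨ t ≠ t') : erlangCDF t' y' < erlangCDF t y := by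
  rcases hne with hne | hne
  · exact (antitone_erlangCDF hy'.le htt').trans_lt
      (strictMonoOn_erlangCDF ht hy'.le (hy'.le.trans hyy') (lt_of_le_of_ne hyy' hne.symm))
  · exact (strictAnti_erlangCDF hy' (lt_of_le_of_ne htt' hne)).trans_le
      (erlangCDF_le_erlangCDF ht le_rfl hy'.le hyy')

lemma erlangCDF_nonneg (t : ℕ) {y : ℝ} (hy : 0 ≤ y) : 0 ≤ erlangCDF t y := by
  rw [erlangCDF, sub_nonneg, Real.exp_neg, inv_mul_le_one₀ (Real.exp_pos y)]
  exact Real.sum_le_exp_of_nonneg hy t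

lemma erlangCDF_pos {t : ℕ} (ht : 0 < t) {y : ℝ} (hy : 0 < y) : 0 < erlangCDF t y := by
  rw [← erlangCDF_zero_right ht]
  exact strictMonoOn_erlangCDF ht Set.self_mem_Ici hy.le hy

lemma one_sub_sum_exp_mul_pow (t : ℕ) (y : ℝ) :
    1 - ∑ j ∈ Finset.range t, Real.exp (-y) / (j.factorial : ℝ) * y ^ j = erlangCDF t y := by
  rw [erlangCDF, Finset.mul_sum]
  simp only [div_mul_eq_mul_div, mul_div_assoc]

end ErlangCDF

section ErlangLaw

lemma setLIntegral_Iic_of_hasDerivAt {g H : ℝ → ℝ} (hneg : ∀ y < 0, g y = 0)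
    (hnonneg : ∀ y, 0 ≤ y → 0 ≤ g y) (hH : ∀ y, 0 ≤ y → HasDerivAt H (g y) y) (x : ℝ) :
    ∫⁻ y in Set.Iic x, ENNReal.ofReal (g y) = ENNReal.ofReal (H (max x 0) - H 0) := by
  have hIio : ∫⁻ y in Set.Iio 0, ENNReal.ofReal (g y) = 0 :=
    setLIntegral_eq_zero measurableSet_Iio fun y hy => by simp [hneg y hy]
  rcases lt_or_ge x 0 with hx | hx
  · rw [max_eq_right hx.le, sub_self, ENNReal.ofReal_zero]
    exact setLIntegral_eq_zero measurableSet_Iic fun y hy => by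
      simp [hneg y (lt_of_le_of_lt hy hx)]
  have hint : IntervalIntegrable g volume 0 x :=
    intervalIntegral.intervalIntegrable_deriv_of_nonneg (g := H)
      (fun y hy => (hH y (by simpa [hx] using hy.1)).continuousAt.continuousWithinAt)
      (fun y hy => hH y (by simpa [hx] using hy.1.le))
      (fun y hy => hnonneg y (by simpa [hx] using hy.1.le))
  rw [max_eq_left hx, lintegral_Iic_eq_lintegral_Iio_add_Icc _ hx, hIio, zero_add,
    ← ofReal_integral_eq_lintegral_ofReal
      ((integrableOn_Icc_iff_integrableOn_Ioc).2 hint.1)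
      ((ae_restrict_iff' measurableSet_Icc).2 (ae_of_all _ fun y hy => hnonneg y hy.1)),
    integral_Icc_eq_integral_Ioc, ← intervalIntegral.integral_of_le hx,
    intervalIntegral.integral_eq_sub_of_hasDerivAt
      (fun y hy => hH y (Set.uIcc_of_le hx ▸ hy).1) hint]

lemma gammaPDFReal_natCast {t : ℕ} (ht : 0 < t) (r : ℝ) {x : ℝ} (hx : 0 ≤ x) :
    gammaPDFReal t r x =
      r ^ t / ((t - 1).factorial : ℝ) * x ^ (t - 1) * Real.exp (-(r * x)) := by
  obtain ⟨d, rfl⟩ := Nat.exists_eq_succ_of_ne_zero ht.ne'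
  rw [gammaPDFReal, if_pos hx, Real.rpow_natCast, Nat.cast_succ, Real.Gamma_nat_eq_factorial,
    add_sub_cancel_right, Real.rpow_natCast, Nat.succ_sub_one]

lemma hasDerivAt_erlangCDF_const_mul {t : ℕ} (ht : 0 < t) (r : ℝ) {x : ℝ} (hx : 0 ≤ x) :
    HasDerivAt (fun y => erlangCDF t (r * y)) (gammaPDFReal t r x) x := by
  obtain ⟨d, rfl⟩ := Nat.exists_eq_succ_of_ne_zero ht.ne'
  refine ((hasDerivAt_erlangCDF_succ d (r * x)).comp x
    ((hasDerivAt_id x).const_mul r)).congr_deriv ?_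
  rw [gammaPDFReal_natCast ht r hx, Nat.succ_sub_one, mul_pow, Nat.succ_eq_add_one, pow_succ]
  ring

lemma isProbabilityMeasure_erlang {t : ℕ} (ht : 0 < t) {r : ℝ} (hr : 0 < r) :
    IsProbabilityMeasure (erlang t r) :=
  isProbabilityMeasure_gammaMeasure (Nat.cast_pos.2 ht) hr

lemma erlang_Iic {t : ℕ} (ht : 0 < t) {r : ℝ} (hr : 0 < r) (x : ℝ) :
    erlang t r (Set.Iic x) = ENNReal.ofReal (erlangCDF t (r * max x 0)) := by
  rw [erlang, gammaMeasure, withDensity_apply _ measurableSet_Iic]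
  simp only [gammaPDF]
  rw [setLIntegral_Iic_of_hasDerivAt (H := fun y => erlangCDF t (r * y))
    (fun y hy => gammaPDFReal_of_neg t r hy)
    (fun y _ => gammaPDFReal_nonneg (Nat.cast_pos.2 ht) hr y)
    (fun y hy => hasDerivAt_erlangCDF_const_mul ht r hy)]
  simp [erlangCDF_zero_right ht]

lemma shiftedErlang_real_Iic {t : ℕ} (ht : 0 < t) (a : ℝ) {r : ℝ} (hr : 0 < r) (x : ℝ) :
    (shiftedErlang t a r).real (Set.Iic x) = erlangCDF t (r * max (x - a) 0) := by
  have hpre : (fun y => y + a) ⁻¹' Set.Iic x = Set.Iic (x - a) := by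
    ext y; simp [le_sub_iff_add_le]
  rw [measureReal_def, shiftedErlang, Measure.map_apply (by fun_prop) measurableSet_Iic, hpre,
    erlang_Iic ht hr, ENNReal.toReal_ofReal (erlangCDF_nonneg t (by positivity))]

lemma isProbabilityMeasure_shiftedErlang {t : ℕ} (ht : 0 < t) (a : ℝ) {r : ℝ} (hr : 0 < r) :
    IsProbabilityMeasure (shiftedErlang t a r) :=
  have := isProbabilityMeasure_erlang ht hr
  Measure.isProbabilityMeasure_map (by fun_prop)

lemma cdf_shiftedErlang {t : ℕ} (ht : 0 < t) (a : ℝ) {r : ℝ} (hr : 0 < r) (x : ℝ) :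
    cdf (shiftedErlang t a r) x = erlangCDF t (r * max (x - a) 0) := by
  have := isProbabilityMeasure_shiftedErlang ht a hr
  rw [cdf_eq_real, shiftedErlang_real_Iic ht a hr]

end ErlangLaw

section ErlangMaxDensity

lemma integrable_iff_of_map_eq_withDensity {Ω : Type*} [MeasurableSpace Ω] {P : Measure Ω}
    {f : Ω → ℝ} (hf : Measurable f) {p : ℝ → ℝ} (hp : Measurable p) (hp0 : ∀ x, 0 ≤ p x)
    (hmap : P.map f = volume.withDensity fun x => ENNReal.ofReal (p x)) :
    Integrable f P ↔ Integrable fun x => x * p x := by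
  rw [← Function.id_comp f, ← integrable_map_measure aestronglyMeasurable_id hf.aemeasurable,
    hmap, integrable_withDensity_iff hp.ennreal_ofReal (by simp)]
  simp only [ENNReal.toReal_ofReal (hp0 _), id]

lemma integral_eq_of_map_eq_withDensity {Ω : Type*} [MeasurableSpace Ω] {P : Measure Ω}
    {f : Ω → ℝ} (hf : Measurable f) {p : ℝ → ℝ} (hp : Measurable p) (hp0 : ∀ x, 0 ≤ p x)
    (hmap : P.map f = volume.withDensity fun x => ENNReal.ofReal (p x)) :
    ∫ ω, f ω ∂P = ∫ x, x * p x := by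
  change ∫ ω, id (f ω) ∂P = _
  rw [← integral_map hf.aemeasurable aestronglyMeasurable_id, hmap,
    integral_withDensity_eq_integral_toReal_smul hp.ennreal_ofReal (by simp)]
  simp only [ENNReal.toReal_ofReal (hp0 _), id, smul_eq_mul, mul_comm]

lemma integral_pow_mul_exp_neg_mul_Ioi (p : ℕ) {b : ℝ} (hb : 0 < b) :
    ∫ x in Set.Ioi (0 : ℝ), x ^ p * Real.exp (-(b * x)) = (p.factorial : ℝ) / b ^ (p + 1) := by
  have h := Real.integral_rpow_mul_exp_neg_mul_Ioi (a := (p : ℝ) + 1) (by positivity) hb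
  rw [add_sub_cancel_right, Real.Gamma_nat_eq_factorial] at h
  simp only [Real.rpow_natCast] at h
  rw [h, ← Nat.cast_succ, Real.rpow_natCast, one_div, inv_pow]
  field_simp

lemma integrableOn_pow_mul_exp_neg_mul_Ioi (p : ℕ) {b : ℝ} (hb : 0 < b) :
    IntegrableOn (fun x : ℝ => x ^ p * Real.exp (-(b * x))) (Set.Ioi 0) := by
  simpa using integrableOn_rpow_mul_exp_neg_mul_rpow (p := 1) (s := p) (b := b)
    (neg_one_lt_zero.trans_le (Nat.cast_nonneg p)) one_pos hb

lemma pow_truncated_exp_eq_sum (t j : ℕ) (x : ℝ) :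
    (∑ i ∈ Finset.range t, x ^ i / (i.factorial : ℝ)) ^ j =
      ∑ l ∈ Finset.range ((t - 1) * j + 1), expandCoeff t j l * x ^ l := by
  set p : Polynomial ℝ := ∑ i ∈ Finset.range t, Polynomial.monomial i (1 / (i.factorial : ℝ))
    with hp
  have hdeg : p.natDegree ≤ t - 1 :=
    Polynomial.natDegree_sum_le_of_forall_le _ _ fun i hi =>
      (Polynomial.natDegree_monomial_le _).trans (Nat.le_sub_one_of_lt (Finset.mem_range.1 hi))
  have hdeg' : (p ^ j).natDegree < (t - 1) * j + 1 := by
    refine Nat.lt_succ_of_le (Polynomial.natDegree_pow_le.trans ?_)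
    rw [mul_comm]
    gcongr
  have heval : p.eval x = ∑ i ∈ Finset.range t, x ^ i / (i.factorial : ℝ) := by
    rw [hp, Polynomial.eval_finsetSum]
    refine Finset.sum_congr rfl fun i _ => ?_
    rw [Polynomial.eval_monomial]; ring
  rw [← heval, ← Polynomial.eval_pow, Polynomial.eval_eq_sum_range' hdeg']
  rfl

lemma erlangCDF_pow_eq_sum (t M : ℕ) (y : ℝ) :
    erlangCDF t y ^ M = ∑ j ∈ Finset.range (M + 1), (-1 : ℝ) ^ j * (M.choose j : ℝ) *
      ∑ l ∈ Finset.range ((t - 1) * j + 1), expandCoeff t j l * (y ^ l * Real.exp (-(j * y))) := by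
  rw [erlangCDF, sub_eq_neg_add, add_pow]
  refine Finset.sum_congr rfl fun j _ => ?_
  rw [neg_pow, mul_pow, ← Real.exp_nat_mul, pow_truncated_exp_eq_sum, one_pow, mul_one, mul_neg]
  simp only [← mul_assoc, ← Finset.sum_mul]
  ring

/-- Density of the maximum of `N` independent Erlang variables with shape `t` and rate `r`. -/
noncomputable def erlangMaxPDFReal (N t : ℕ) (r x : ℝ) : ℝ :=
  N * erlangCDF t (r * x) ^ (N - 1) * gammaPDFReal t r x

lemma measurable_erlangMaxPDFReal (N t : ℕ) (r : ℝ) : Measurable (erlangMaxPDFReal N t r) := by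
  have := (continuous_erlangCDF t).measurable
  have := measurable_gammaPDFReal t r
  unfold erlangMaxPDFReal
  fun_prop

lemma erlangMaxPDFReal_of_neg (N t : ℕ) (r : ℝ) {x : ℝ} (hx : x < 0) :
    erlangMaxPDFReal N t r x = 0 := by
  rw [erlangMaxPDFReal, gammaPDFReal_of_neg _ _ hx, mul_zero]

lemma mul_erlangMaxPDFReal_of_nonpos (N t : ℕ) (r : ℝ) {x : ℝ} (hx : x ≤ 0) :
    x * erlangMaxPDFReal N t r x = 0 := by
  rcases hx.lt_or_eq with hx | rfl
  · rw [erlangMaxPDFReal_of_neg N t r hx, mul_zero]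
  · rw [zero_mul]

lemma erlangMaxPDFReal_nonneg (N : ℕ) {t : ℕ} (ht : 0 < t) {r : ℝ} (hr : 0 < r) (x : ℝ) :
    0 ≤ erlangMaxPDFReal N t r x := by
  rcases lt_or_ge x 0 with hx | hx
  · exact (erlangMaxPDFReal_of_neg N t r hx).ge
  · have := erlangCDF_nonneg t (mul_nonneg hr.le hx)
    have := gammaPDFReal_nonneg (Nat.cast_pos.2 ht) hr x
    unfold erlangMaxPDFReal
    positivity

lemma setLIntegral_Iic_erlangMaxPDFReal {N t : ℕ} (hN : N ≠ 0) (ht : 0 < t) {r : ℝ} (hr : 0 < r)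
    (x : ℝ) :
    ∫⁻ y in Set.Iic x, ENNReal.ofReal (erlangMaxPDFReal N t r y) =
      ENNReal.ofReal (erlangCDF t (r * max x 0) ^ N) := by
  rw [setLIntegral_Iic_of_hasDerivAt (fun y hy => erlangMaxPDFReal_of_neg N t r hy)
    (fun y _ => erlangMaxPDFReal_nonneg N ht hr y)
    (fun y hy => (hasDerivAt_erlangCDF_const_mul ht r hy).pow N)]
  simp [erlangCDF_zero_right ht, hN]

lemma mul_erlangMaxPDFReal_eq_sum {N t : ℕ} (hN : N ≠ 0) (ht : 0 < t) (r : ℝ) {x : ℝ}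
    (hx : 0 ≤ x) :
    x * erlangMaxPDFReal N t r x = N * r ^ t / ((t - 1).factorial : ℝ) *
      ∑ j ∈ Finset.range N, (-1 : ℝ) ^ j * ((N - 1).choose j : ℝ) *
        ∑ l ∈ Finset.range ((t - 1) * j + 1), expandCoeff t j l * r ^ l *
          (x ^ (t + l) * Real.exp (-((j + 1) * r * x))) := by
  have hpow : x ^ t = x * x ^ (t - 1) := by rw [← pow_succ', Nat.sub_add_cancel ht]
  have hexp : ∀ j : ℕ, Real.exp (-((j + 1) * r * x)) =
      Real.exp (-(r * x)) * Real.exp (-(j * (r * x))) := fun j => by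
    rw [← Real.exp_add]; ring_nf
  have hterm : ∀ j l : ℕ, expandCoeff t j l * r ^ l *
      (x ^ (t + l) * Real.exp (-((j + 1) * r * x))) = x * x ^ (t - 1) * Real.exp (-(r * x)) *
        (expandCoeff t j l * ((r * x) ^ l * Real.exp (-(j * (r * x))))) := fun j l => by
    rw [hexp, pow_add, hpow, mul_pow]; ring
  simp only [hterm, ← Finset.mul_sum, mul_left_comm _ (x * x ^ (t - 1) * Real.exp (-(r * x)))]
  rw [erlangMaxPDFReal, gammaPDFReal_natCast ht r hx, erlangCDF_pow_eq_sum,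
    Nat.sub_add_cancel (Nat.one_le_iff_ne_zero.2 hN)]
  ring

lemma integrable_mul_erlangMaxPDFReal {N t : ℕ} (hN : N ≠ 0) (ht : 0 < t) {r : ℝ} (hr : 0 < r) :
    Integrable fun x => x * erlangMaxPDFReal N t r x := by
  rw [← integrableOn_iff_integrable_of_support_subset (s := Set.Ioi 0) fun x hx =>
      not_le.1 fun hx0 => hx (mul_erlangMaxPDFReal_of_nonpos N t r hx0),
    integrableOn_congr_fun (fun x hx => mul_erlangMaxPDFReal_eq_sum hN ht r (Set.mem_Ioi.1 hx).le)
      measurableSet_Ioi]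
  exact (integrable_finsetSum _ fun j _ => (integrable_finsetSum _ fun l _ =>
    (integrableOn_pow_mul_exp_neg_mul_Ioi (t + l) (by positivity)).const_mul _).const_mul _
      ).const_mul _

lemma integral_mul_erlangMaxPDFReal {N t : ℕ} (hN : N ≠ 0) (ht : 0 < t) {r : ℝ} (hr : 0 < r) :
    ∫ x, x * erlangMaxPDFReal N t r x = erlangMaxMean N t r := by
  have hint : ∀ j l : ℕ, IntegrableOn (fun x : ℝ => expandCoeff t j l * r ^ l *
      (x ^ (t + l) * Real.exp (-((j + 1) * r * x)))) (Set.Ioi 0) := fun j l =>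
    (integrableOn_pow_mul_exp_neg_mul_Ioi (t + l) (by positivity)).const_mul _
  have hmoment : ∀ j l : ℕ, ∫ x in Set.Ioi (0 : ℝ), expandCoeff t j l * r ^ l *
      (x ^ (t + l) * Real.exp (-((j + 1) * r * x))) = (r * r ^ t)⁻¹ *
        (expandCoeff t j l * ((t + l).factorial : ℝ) / ((j : ℝ) + 1) ^ (t + l + 1)) := fun j l => by
    rw [integral_const_mul, integral_pow_mul_exp_neg_mul_Ioi _ (by positivity), mul_pow]
    field_simp
    ring
  rw [← setIntegral_eq_integral_of_forall_compl_eq_zero (s := Set.Ioi 0)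
      fun x hx => mul_erlangMaxPDFReal_of_nonpos N t r (not_lt.1 hx),
    setIntegral_congr_fun measurableSet_Ioi
      (fun x hx => mul_erlangMaxPDFReal_eq_sum hN ht r (Set.mem_Ioi.1 hx).le),
    integral_const_mul, integral_finsetSum _ fun j _ =>
      (integrable_finsetSum _ fun l _ => hint j l).const_mul _]
  simp only [integral_const_mul, integral_finsetSum _ fun l _ => hint _ l, hmoment,
    ← Finset.mul_sum, mul_left_comm _ (r * r ^ t)⁻¹]
  rw [erlangMaxMean]
  field_simp

end ErlangMaxDensity

section StochasticDominance

lemma ae_lt_of_measureReal_le_eq_zero {Ω : Type*} [MeasurableSpace Ω] {P : Measure Ω}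
    [IsFiniteMeasure P] {f : Ω → ℝ} {a : ℝ} (h : P.real {ω | f ω ≤ a} = 0) :
    ∀ᵐ ω ∂P, a < f ω := by
  simpa only [ae_iff, not_lt] using (measureReal_eq_zero_iff (measure_ne_top _ _)).1 h

variable {Ω Ω' : Type*} [MeasurableSpace Ω] [MeasurableSpace Ω'] {P : Measure Ω}
  [IsProbabilityMeasure P] {Q : Measure Ω'} [IsProbabilityMeasure Q]

lemma measureReal_lt_eq_one_sub {f : Ω → ℝ} (hf : AEMeasurable f P) (x : ℝ) :
    P.real {ω | x < f ω} = 1 - P.real {ω | f ω ≤ x} := by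
  rw [← probReal_compl_eq_one_sub₀ (nullMeasurableSet_le hf aemeasurable_const)]
  congr 1
  ext ω
  simp

lemma lintegral_ofReal_sub_le_of_measureReal_le_le {f : Ω → ℝ} {g : Ω' → ℝ} {a : ℝ}
    (hf : AEMeasurable f P) (hg : AEMeasurable g Q) (hfa : ∀ᵐ ω ∂P, a < f ω)
    (hga : ∀ᵐ ω ∂Q, a < g ω) (h : ∀ x, Q.real {ω | g ω ≤ x} ≤ P.real {ω | f ω ≤ x}) :
    ∫⁻ ω, ENNReal.ofReal (f ω - a) ∂P ≤ ∫⁻ ω, ENNReal.ofReal (g ω - a) ∂Q := by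
  rw [lintegral_eq_lintegral_meas_lt P (hfa.mono fun ω h => sub_nonneg.2 h.le)
      (hf.sub_const a),
    lintegral_eq_lintegral_meas_lt Q (hga.mono fun ω h => sub_nonneg.2 h.le) (hg.sub_const a)]
  refine lintegral_mono fun x => ?_
  simp only [lt_sub_iff_add_lt]
  rw [← ENNReal.toReal_le_toReal (measure_ne_top _ _) (measure_ne_top _ _)]
  change P.real {ω | x + a < f ω} ≤ Q.real {ω | x + a < g ω}
  rw [measureReal_lt_eq_one_sub hf, measureReal_lt_eq_one_sub hg]
  exact sub_le_sub_left (h _) 1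

lemma integrable_and_integral_le_of_measureReal_le_le {f : Ω → ℝ} {g : Ω' → ℝ} {a : ℝ}
    (hf : AEMeasurable f P) (hg : Integrable g Q) (hfa : P.real {ω | f ω ≤ a} = 0)
    (h : ∀ x, Q.real {ω | g ω ≤ x} ≤ P.real {ω | f ω ≤ x}) :
    Integrable f P ∧ ∫ ω, f ω ∂P ≤ ∫ ω, g ω ∂Q := by
  have hfa' := ae_lt_of_measureReal_le_eq_zero hfa
  have hga' := ae_lt_of_measureReal_le_eq_zero
    (le_antisymm ((h a).trans_eq hfa) measureReal_nonneg)
  have hle := lintegral_ofReal_sub_le_of_measureReal_le_le hf hg.aemeasurable hfa' hga' h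
  have hf0 : 0 ≤ᵐ[P] fun ω => f ω - a := hfa'.mono fun ω h => sub_nonneg.2 h.le
  have hg0 : 0 ≤ᵐ[Q] fun ω => g ω - a := hga'.mono fun ω h => sub_nonneg.2 h.le
  have hgsub : Integrable (fun ω => g ω - a) Q := hg.sub (integrable_const a)
  rw [← ofReal_integral_eq_lintegral_ofReal hgsub hg0] at hle
  have hfsub : Integrable (fun ω => f ω - a) P :=
    (lintegral_ofReal_ne_top_iff_integrable (hf.sub_const a).aestronglyMeasurable hf0).1
      (hle.trans_lt ENNReal.ofReal_lt_top).ne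
  have hfint : Integrable f P := by
    simpa only [Pi.add_def, sub_add_cancel] using hfsub.add (integrable_const a)
  rw [← ofReal_integral_eq_lintegral_ofReal hfsub hf0,
    ENNReal.ofReal_le_ofReal_iff (integral_nonneg_of_ae hg0),
    integral_sub hfint (integrable_const a), integral_sub hg (integrable_const a)] at hle
  refine ⟨hfint, ?_⟩
  simpa using hle

end StochasticDominance

section IndependentFamilies

variable {Ω : Type*} [MeasurableSpace Ω] {P : Measure Ω}

lemma iIndepFun_curry {ι : Type*} {κ : ι → Type*} {𝓧 : (i : ι) → κ i → Type*}
    [∀ i j, MeasurableSpace (𝓧 i j)] {Z : (i : ι) → (j : κ i) → Ω → 𝓧 i j}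
    (hZ : ∀ i j, Measurable (Z i j))
    (h : iIndepFun (fun p : (i : ι) × κ i => Z p.1 p.2) P) :
    iIndepFun (fun i ω j => Z i j ω) P := by
  have := h.isProbabilityMeasure
  have : ∀ i j, IsProbabilityMeasure (P.map (Z i j)) :=
    fun i j => Measure.isProbabilityMeasure_map (hZ i j).aemeasurable
  have hcurry : MeasurableEquiv.piCurry 𝓧 ∘
      (fun ω (p : (i : ι) × κ i) => Z p.1 p.2 ω) = fun ω i j => Z i j ω := by
    ext; simp [Sigma.curry]
  have hjoint : P.map (fun ω (p : (i : ι) × κ i) => Z p.1 p.2 ω) =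
      Measure.infinitePi fun p : (i : ι) × κ i => P.map (Z p.1 p.2) :=
    h.map_fun_eq_infinitePi_map fun p => hZ p.1 p.2
  rw [iIndepFun_iff_map_fun_eq_infinitePi_map (by fun_prop), ← hcurry,
    ← Measure.map_map (by fun_prop) (by fun_prop), hjoint,
    Measure.infinitePi_map_piCurry (fun i j => P.map (Z i j))]
  congr 1
  funext i
  exact ((h.precomp (g := fun j => (⟨i, j⟩ : (i : ι) × κ i))
    (fun a b hab => by simpa using hab)).map_fun_eq_infinitePi_map fun j => hZ i j).symm

lemma measure_iSup_le_of_iIndepFun {ι : Type*} [Fintype ι] [Nonempty ι] {Y : ι → Ω → ℝ}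
    (hY : ∀ i, Measurable (Y i)) (hind : iIndepFun Y P) (x : ℝ) :
    P {ω | ⨆ i, Y i ω ≤ x} = ∏ i, P.map (Y i) (Set.Iic x) := by
  have hset : {ω | ⨆ i, Y i ω ≤ x} = ⋂ i ∈ Finset.univ, Y i ⁻¹' Set.Iic x := by
    ext ω
    simp [ciSup_le_iff (Set.finite_range fun i => Y i ω).bddAbove]
  rw [hset, hind.measure_inter_preimage_eq_mul _ fun _ _ => measurableSet_Iic]
  exact Finset.prod_congr rfl fun i _ => (Measure.map_apply (hY i) measurableSet_Iic).symm

end IndependentFamilies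

section ErlangFamilies

/-- The random variables `Y i` are independent and `Y i` is Erlang with shape `t i` and rate `r i`,
shifted by `a i`. -/
structure IsIndepShiftedErlang {Ω : Type*} [MeasurableSpace Ω] (P : Measure Ω) {ι : Type*}
    (Y : ι → Ω → ℝ) (t : ι → ℕ) (a r : ι → ℝ) : Prop where
  measurable : ∀ i, Measurable (Y i)
  indep : iIndepFun Y P
  law : ∀ i, P.map (Y i) = shiftedErlang (t i) (a i) (r i)
  shape_pos : ∀ i, 0 < t i
  rate_pos : ∀ i, 0 < r i

lemma isIndepShiftedErlang_pi (ι : Type*) [Fintype ι] {t : ℕ} (ht : 0 < t) {r : ℝ} (hr : 0 < r) :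
    IsIndepShiftedErlang (Measure.pi fun _ : ι => erlang t r) (fun i y => y i) (fun _ => t)
      (fun _ => 0) (fun _ => r) := by
  have := isProbabilityMeasure_erlang ht hr
  refine ⟨measurable_pi_apply, iIndepFun_pi (X := fun _ x => x) fun _ => aemeasurable_id,
    fun i => ?_, fun _ => ht, fun _ => hr⟩
  rw [(measurePreserving_eval _ i).map_eq]
  simp [shiftedErlang]

namespace IsIndepShiftedErlang

variable {Ω : Type*} [MeasurableSpace Ω] {P : Measure Ω} {ι : Type*} {Y : ι → Ω → ℝ} {t : ι → ℕ}
  {a r : ι → ℝ}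

lemma measurable_iSup [Countable ι] (hY : IsIndepShiftedErlang P Y t a r) :
    Measurable fun ω => ⨆ i, Y i ω :=
  Measurable.iSup hY.measurable

lemma measureReal_iSup_le [Fintype ι] [Nonempty ι] (hY : IsIndepShiftedErlang P Y t a r) (x : ℝ) :
    P.real {ω | ⨆ i, Y i ω ≤ x} = ∏ i, erlangCDF (t i) (r i * max (x - a i) 0) := by
  rw [measureReal_def, measure_iSup_le_of_iIndepFun hY.measurable hY.indep, ENNReal.toReal_prod]
  refine Finset.prod_congr rfl fun i _ => ?_
  rw [hY.law, ← shiftedErlang_real_Iic (hY.shape_pos i) (a i) (hY.rate_pos i), measureReal_def]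

lemma measureReal_iSup_le_eq_zero [Finite ι] (hY : IsIndepShiftedErlang P Y t a r) {i : ι} {x : ℝ}
    (hx : x ≤ a i) : P.real {ω | ⨆ i, Y i ω ≤ x} = 0 := by
  have := Fintype.ofFinite ι
  have : Nonempty ι := ⟨i⟩
  rw [hY.measureReal_iSup_le]
  refine Finset.prod_eq_zero (Finset.mem_univ i) ?_
  rw [max_eq_right (sub_nonpos.2 hx), mul_zero, erlangCDF_zero_right (hY.shape_pos i)]

variable [Fintype ι] [Nonempty ι] {t' : ℕ} {a' r' : ℝ}

lemma pow_le_measureReal_iSup_le (hY : IsIndepShiftedErlang P Y t a r) (ht : ∀ i, t i ≤ t')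
    (ha : ∀ i, a i ≤ a') (hr' : 0 < r') (hr : ∀ i, r' ≤ r i) (x : ℝ) :
    erlangCDF t' (r' * max (x - a') 0) ^ Fintype.card ι ≤ P.real {ω | ⨆ i, Y i ω ≤ x} := by
  rw [hY.measureReal_iSup_le, ← Finset.card_univ, ← Finset.prod_const]
  refine Finset.prod_le_prod (fun _ _ => erlangCDF_nonneg t' (by positivity)) fun i _ => ?_
  refine erlangCDF_le_erlangCDF (hY.shape_pos i) (ht i) (by positivity) ?_
  have := hY.rate_pos i
  gcongr
  exacts [hr i, ha i]

lemma measureReal_lt_iSup_le (hY : IsIndepShiftedErlang P Y t a r) (ht : ∀ i, t i ≤ t')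
    (ha : ∀ i, a i ≤ a') (hr' : 0 < r') (hr : ∀ i, r' ≤ r i) {x : ℝ} (hx : a' ≤ x) :
    P.real {ω | x < ⨆ i, Y i ω} ≤ 1 - erlangCDF t' (r' * (x - a')) ^ Fintype.card ι := by
  have := hY.indep.isProbabilityMeasure
  rw [measureReal_lt_eq_one_sub hY.measurable_iSup.aemeasurable]
  simpa only [max_eq_left (sub_nonneg.2 hx)] using
    sub_le_sub_left (hY.pow_le_measureReal_iSup_le ht ha hr' hr x) 1

lemma measureReal_lt_iSup_lt (hY : IsIndepShiftedErlang P Y t a r) (ht : ∀ i, t i ≤ t')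
    (ha : ∀ i, a i ≤ a') (hr' : 0 < r') (hr : ∀ i, r' ≤ r i) (hne : ∃ i, r i ≠ r' ∨ t i ≠ t')
    {x : ℝ} (hx : a' < x) :
    P.real {ω | x < ⨆ i, Y i ω} < 1 - erlangCDF t' (r' * (x - a')) ^ Fintype.card ι := by
  have := hY.indep.isProbabilityMeasure
  have hx' : 0 < x - a' := sub_pos.2 hx
  have ht' : 0 < t' := hne.elim fun i _ => (hY.shape_pos i).trans_le (ht i)
  have hxa : ∀ i, x - a' ≤ max (x - a i) 0 := fun i =>
    (sub_le_sub_left (ha i) x).trans (le_max_left _ _)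
  have hle : ∀ i, r' * (x - a') ≤ r i * max (x - a i) 0 := fun i =>
    mul_le_mul (hr i) (hxa i) hx'.le (hY.rate_pos i).le
  rw [measureReal_lt_eq_one_sub hY.measurable_iSup.aemeasurable, hY.measureReal_iSup_le,
    ← Finset.card_univ, ← Finset.prod_const]
  obtain ⟨i, hi⟩ := hne
  refine sub_lt_sub_left (Finset.prod_lt_prod (fun _ _ => erlangCDF_pos ht' (by positivity))
    (fun j _ => erlangCDF_le_erlangCDF (hY.shape_pos j) (ht j) (by positivity) (hle j))
    ⟨i, Finset.mem_univ i, erlangCDF_lt_erlangCDF (hY.shape_pos i) (ht i) (by positivity) (hle i)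
      (hi.imp_left fun hri => ?_)⟩) 1
  exact (mul_lt_mul (lt_of_le_of_ne (hr i) hri.symm) (hxa i) hx' (hY.rate_pos i).le).ne'

end IsIndepShiftedErlang

section ErlangMaximum

variable {ι : Type*} [Fintype ι] [Nonempty ι] {t : ℕ} {r : ℝ}

lemma map_iSup_pi_erlang (ht : 0 < t) (hr : 0 < r) :
    (Measure.pi fun _ : ι => erlang t r).map (fun y => ⨆ i, y i) =
      volume.withDensity fun x => ENNReal.ofReal (erlangMaxPDFReal (Fintype.card ι) t r x) := by
  have := isProbabilityMeasure_erlang ht hr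
  have hpi := isIndepShiftedErlang_pi ι ht hr
  have := Measure.isProbabilityMeasure_map (μ := Measure.pi fun _ : ι => erlang t r)
    hpi.measurable_iSup.aemeasurable
  refine Measure.ext_of_Iic _ _ fun x => ?_
  have hcdf := hpi.measureReal_iSup_le x
  rw [sub_zero, Finset.prod_const, Finset.card_univ] at hcdf
  rw [Measure.map_apply hpi.measurable_iSup measurableSet_Iic,
    withDensity_apply _ measurableSet_Iic,
    setLIntegral_Iic_erlangMaxPDFReal Fintype.card_ne_zero ht hr, ← hcdf, ofReal_measureReal]
  rfl

lemma integrable_iSup_pi_erlang (ht : 0 < t) (hr : 0 < r) :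
    Integrable (fun y : ι → ℝ => ⨆ i, y i) (Measure.pi fun _ => erlang t r) :=
  (integrable_iff_of_map_eq_withDensity (isIndepShiftedErlang_pi ι ht hr).measurable_iSup
    (measurable_erlangMaxPDFReal _ t r) (erlangMaxPDFReal_nonneg _ ht hr)
    (map_iSup_pi_erlang ht hr)).2 (integrable_mul_erlangMaxPDFReal Fintype.card_ne_zero ht hr)

lemma integral_iSup_pi_erlang (ht : 0 < t) (hr : 0 < r) :
    ∫ y : ι → ℝ, (⨆ i, y i) ∂(Measure.pi fun _ => erlang t r) =
      erlangMaxMean (Fintype.card ι) t r :=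
  (integral_eq_of_map_eq_withDensity (isIndepShiftedErlang_pi ι ht hr).measurable_iSup
    (measurable_erlangMaxPDFReal _ t r) (erlangMaxPDFReal_nonneg _ ht hr)
    (map_iSup_pi_erlang ht hr)).trans (integral_mul_erlangMaxPDFReal Fintype.card_ne_zero ht hr)

end ErlangMaximum

lemma IsIndepShiftedErlang.integrable_iSup_and_integral_iSup_le
    {Ω : Type*} [MeasurableSpace Ω] {P : Measure Ω} {ι : Type*} [Fintype ι] [Nonempty ι]
    {Y : ι → Ω → ℝ} {t : ι → ℕ} {a r : ι → ℝ} {t' : ℕ} {a' r' : ℝ}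
    (hY : IsIndepShiftedErlang P Y t a r) (ht : ∀ i, t i ≤ t') (ha : ∀ i, a i ≤ a')
    (ha' : ∃ i, a i = a') (hr' : 0 < r') (hr : ∀ i, r' ≤ r i) :
    Integrable (fun ω => ⨆ i, Y i ω) P ∧
      ∫ ω, ⨆ i, Y i ω ∂P ≤ a' + erlangMaxMean (Fintype.card ι) t' r' := by
  have := hY.indep.isProbabilityMeasure
  obtain ⟨i₀, hi₀⟩ := ha'
  have ht' : 0 < t' := (hY.shape_pos i₀).trans_le (ht i₀)
  have := isProbabilityMeasure_erlang ht' hr'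
  have hpi := isIndepShiftedErlang_pi ι ht' hr'
  have hint := integrable_iSup_pi_erlang (ι := ι) ht' hr'
  have hcdf : ∀ x, (Measure.pi fun _ : ι => erlang t' r').real {y | (⨆ i, y i) + a' ≤ x} ≤
      P.real {ω | ⨆ i, Y i ω ≤ x} := fun x => by
    simp only [← le_sub_iff_add_le]
    refine le_trans (le_of_eq ?_) (hY.pow_le_measureReal_iSup_le ht ha hr' hr x)
    rw [hpi.measureReal_iSup_le, sub_zero, Finset.prod_const, Finset.card_univ]
  obtain ⟨hYint, hle⟩ := integrable_and_integral_le_of_measureReal_le_le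
    hY.measurable_iSup.aemeasurable (hint.add (integrable_const a'))
    (hY.measureReal_iSup_le_eq_zero hi₀.ge) hcdf
  refine ⟨hYint, hle.trans_eq ?_⟩
  rw [integral_add' hint (integrable_const a'), integral_iSup_pi_erlang ht' hr']
  simp [add_comm]

end ErlangFamilies

section AdditiveServiceTime

lemma map_sub_shiftedExp (a r : ℝ) : (shiftedExp a r).map (fun x => x - a) = expMeasure r := by
  rw [shiftedExp, Measure.map_map (by fun_prop) (by fun_prop)]
  simp [Function.comp_def]

lemma map_sum_eq_shiftedErlang {Ω : Type*} [MeasurableSpace Ω] {P : Measure Ω} {ι : Type*}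
    [Fintype ι] [Nonempty ι] {a r : ℝ} (hr : 0 < r) {Y : ι → Ω → ℝ} (hY : ∀ i, Measurable (Y i))
    (hlaw : ∀ i, P.map (Y i) = shiftedExp a r) (hind : iIndepFun Y P) :
    P.map (fun ω => ∑ i, Y i ω) = shiftedErlang (Fintype.card ι) (Fintype.card ι * a) r := by
  have hlaw' : ∀ i, P.map (fun ω => Y i ω - a) = gammaMeasure 1 r := fun i => by
    rw [← expMeasure, ← map_sub_shiftedExp a r, ← hlaw i, Measure.map_map (by fun_prop) (hY i)]
    rfl
  have hsum := map_sum_eq_gammaMeasure hr (fun _ : ι => one_pos)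
    (fun i => (hY i).sub_const a) hlaw' (hind.comp (fun _ x => x - a) fun _ => by fun_prop)
    Finset.univ_nonempty
  rw [Finset.sum_const, Finset.card_univ, nsmul_one] at hsum
  rw [shiftedErlang, erlang, ← hsum, Measure.map_map (by fun_prop) (by fun_prop)]
  congr 1
  funext ω
  simp [Finset.sum_apply]

lemma one_sub_sum_exp_shift (t : ℕ) (l x a : ℝ) {K : ℝ} (hK : K ≠ 0) :
    1 - ∑ j ∈ Finset.range t,
      Real.exp (l * a - l * K * x) / (j.factorial : ℝ) * (l * K * x - l * a) ^ j =
      erlangCDF t (l * K * (x - a / K)) := by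
  rw [← one_sub_sum_exp_mul_pow]
  field_simp
  ring_nf

lemma waitingTime_eq_iSup {Ω : Type*} {c : ℕ} {n τ : Fin c → ℕ} (hn : ∀ u, 0 < n u)
    (X : (u : Fin c) → Fin (n u) → Fin (τ u) → Ω → ℝ) :
    waitingTime X = fun ω => ⨆ p : (u : Fin c) × Fin (n u), workerTime X p.1 p.2 ω := by
  have : ∀ u, Nonempty (Fin (n u)) := fun u => ⟨⟨0, hn u⟩⟩
  funext ω
  rcases isEmpty_or_nonempty (Fin c) with _ | ⟨⟨u⟩⟩
  · simp [waitingTime]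
  · have : Nonempty (Fin c) := ⟨u⟩
    have : Nonempty ((u : Fin c) × Fin (n u)) := ⟨⟨u, 0, hn u⟩⟩
    refine eq_of_forall_ge_iff fun x => ?_
    simp only [waitingTime, clusterTime, ciSup_le_iff (Set.finite_range _).bddAbove, Sigma.forall]

namespace IsAdditiveServiceTime

variable {Ω : Type*} [MeasurableSpace Ω] {P : Measure Ω} {k m : ℕ} {c : ℕ} {n τ : Fin c → ℕ}
  {lam s : Fin c → ℝ} {X : (u : Fin c) → Fin (n u) → Fin (τ u) → Ω → ℝ}

lemma measurable_workerTime (hX : IsAdditiveServiceTime P k m n τ lam s X) (u : Fin c)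
    (i : Fin (n u)) : Measurable (workerTime X u i) :=
  Finset.measurable_sum _ fun j _ => hX.measurable u i j

lemma map_workerTime (hX : IsAdditiveServiceTime P k m n τ lam s X) (hk : 0 < k) (hm : 0 < m)
    {u : Fin c} (hτ : 0 < τ u) (hlam : 0 < lam u) (i : Fin (n u)) :
    P.map (workerTime X u i) =
      shiftedErlang (τ u) (τ u * s u / (k * m)) (lam u * (k * m)) := by
  have : Nonempty (Fin (τ u)) := ⟨⟨0, hτ⟩⟩
  have hind : iIndepFun (X u i) P :=
    hX.indep.precomp (g := fun j => (⟨u, (i, j)⟩ : (u : Fin c) × (Fin (n u) × Fin (τ u))))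
      fun j j' h => by simpa using h
  have hsum := map_sum_eq_shiftedErlang (by positivity) (hX.measurable u i) (hX.law u i) hind
  rwa [Fintype.card_fin, ← mul_div_assoc] at hsum

lemma iIndepFun_workerTime (hX : IsAdditiveServiceTime P k m n τ lam s X) :
    iIndepFun (fun p : (u : Fin c) × Fin (n u) => workerTime X p.1 p.2) P := by
  have hinj : Function.Injective (fun q : (p : (u : Fin c) × Fin (n u)) × Fin (τ p.1) =>
      (⟨q.1.1, (q.1.2, q.2)⟩ : (u : Fin c) × (Fin (n u) × Fin (τ u)))) := by
    rintro ⟨⟨u, i⟩, j⟩ ⟨⟨u', i'⟩, j'⟩ h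
    obtain ⟨rfl, h⟩ := Sigma.mk.inj_iff.1 h
    simp only [heq_eq_eq, Prod.mk.injEq] at h
    obtain ⟨rfl, rfl⟩ := h
    rfl
  have hgroup := iIndepFun_curry (Z := fun (p : (u : Fin c) × Fin (n u)) (j : Fin (τ p.1)) =>
    X p.1 p.2 j) (fun p j => hX.measurable _ _ _) (hX.indep.precomp hinj)
  exact hgroup.comp (fun p (y : Fin (τ p.1) → ℝ) => ∑ j, y j) (fun p => by fun_prop)

lemma isIndepShiftedErlang_workerTime (hX : IsAdditiveServiceTime P k m n τ lam s X) (hk : 0 < k)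
    (hm : 0 < m) (hτ : ∀ u, 0 < τ u) (hlam : ∀ u, 0 < lam u) :
    IsIndepShiftedErlang P (fun p : (u : Fin c) × Fin (n u) => workerTime X p.1 p.2)
      (fun p => τ p.1) (fun p => τ p.1 * s p.1 / (k * m)) (fun p => lam p.1 * (k * m)) where
  measurable p := hX.measurable_workerTime p.1 p.2
  indep := hX.iIndepFun_workerTime
  law p := hX.map_workerTime hk hm (hτ p.1) (hlam p.1) p.2
  shape_pos p := hτ p.1
  rate_pos p := by have := hlam p.1; positivity

end IsAdditiveServiceTime

end AdditiveServiceTime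

theorem theorem3_general {Ω : Type*} [MeasurableSpace Ω] (P : Measure Ω)
    (k m : ℕ) (hk : 0 < k) (hm : 0 < m)
    {c : ℕ} (n τ : Fin c → ℕ) (hn : ∀ u, 0 < n u) (hτ : ∀ u, 0 < τ u)
    (lam s : Fin c → ℝ) (hlam : ∀ u, 0 < lam u)
    (slow : Fin c) (hslow : ∀ u, lam slow ≤ lam u)
    (X : (u : Fin c) → Fin (n u) → Fin (τ u) → Ω → ℝ)
    (hX : IsAdditiveServiceTime P k m n τ lam s X)
    (N τmax : ℕ) (hN : N = ∑ u, n u) (hτmax : IsGreatest (Set.range τ) τmax)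
    (sm : ℝ) (hsm : IsGreatest (Set.range fun u => s u * (τ u : ℝ)) sm) :
    (∀ u i, P.map (workerTime X u i) =
      shiftedErlang (τ u) (τ u * s u / (k * m)) (lam u * (k * m))) ∧
    (∀ x : ℝ, sm / (k * m) ≤ x →
      P.real {ω | x < waitingTime X ω} ≤
        1 - (1 - ∑ j ∈ Finset.range τmax,
          Real.exp (lam slow * sm - lam slow * (k * m) * x) / (j.factorial : ℝ) *
            (lam slow * (k * m) * x - lam slow * sm) ^ j) ^ N) ∧
    ((∃ u, lam u ≠ lam slow ∨ τ u ≠ τmax) → ∀ x : ℝ, sm / (k * m) < x →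
      P.real {ω | x < waitingTime X ω} <
        1 - (1 - ∑ j ∈ Finset.range τmax,
          Real.exp (lam slow * sm - lam slow * (k * m) * x) / (j.factorial : ℝ) *
            (lam slow * (k * m) * x - lam slow * sm) ^ j) ^ N) ∧
    (∀ x : ℝ, x < sm / (k * m) → P.real {ω | waitingTime X ω ≤ x} = 0) ∧
    (∀ x : ℝ, sm / (k * m) ≤ x →
      cdf (shiftedErlang τmax (sm / (k * m)) (lam slow * (k * m))) x =
        1 - ∑ j ∈ Finset.range τmax,
          Real.exp (lam slow * sm - lam slow * (k * m) * x) / (j.factorial : ℝ) *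
            (lam slow * (k * m) * x - lam slow * sm) ^ j) ∧
    (Integrable (waitingTime X) P ∧
      ∫ ω, waitingTime X ω ∂P ≤ sm / (k * m) + erlangMaxMean N τmax (lam slow * (k * m))) ∧
    (Integrable (fun y : Fin N → ℝ => ⨆ i, y i)
        (Measure.pi fun _ : Fin N => erlang τmax (lam slow * (k * m))) ∧
      ∫ y : Fin N → ℝ, (⨆ i, y i)
          ∂(Measure.pi fun _ : Fin N => erlang τmax (lam slow * (k * m))) =
        erlangMaxMean N τmax (lam slow * (k * m))) := by
  have hK : 0 < (k : ℝ) * m := by positivity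
  have hY := hX.isIndepShiftedErlang_workerTime hk hm hτ hlam
  have hshape : ∀ p : (u : Fin c) × Fin (n u), τ p.1 ≤ τmax := fun p => hτmax.2 ⟨p.1, rfl⟩
  have hshift : ∀ p : (u : Fin c) × Fin (n u), τ p.1 * s p.1 / (k * m) ≤ sm / (k * m) := fun p =>
    div_le_div_of_nonneg_right (mul_comm (s p.1) _ ▸ hsm.2 ⟨p.1, rfl⟩) hK.le
  obtain ⟨u₀, hu₀⟩ := hsm.1
  let p₀ : (u : Fin c) × Fin (n u) := ⟨u₀, 0, hn u₀⟩
  have hp₀ : τ p₀.1 * s p₀.1 / (k * m) = sm / (k * m) := by rw [← hu₀, mul_comm]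
  have hrate : ∀ p : (u : Fin c) × Fin (n u), lam slow * (k * m) ≤ lam p.1 * (k * m) := fun p =>
    mul_le_mul_of_nonneg_right (hslow p.1) hK.le
  have hslow_pos : 0 < lam slow * (k * m) := mul_pos (hlam slow) hK
  have hτmax_pos : 0 < τmax := (hτ u₀).trans_le (hshape p₀)
  have : Nonempty ((u : Fin c) × Fin (n u)) := ⟨p₀⟩
  obtain rfl : N = Fintype.card ((u : Fin c) × Fin (n u)) := by simp [hN]
  have : NeZero (Fintype.card ((u : Fin c) × Fin (n u))) := ⟨Fintype.card_ne_zero⟩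
  simp only [one_sub_sum_exp_shift _ _ _ _ hK.ne', waitingTime_eq_iSup hn]
  refine ⟨fun u i => hX.map_workerTime hk hm (hτ u) (hlam u) i,
    fun x hx => hY.measureReal_lt_iSup_le hshape hshift hslow_pos hrate hx,
    fun ⟨u, hu⟩ x hx => hY.measureReal_lt_iSup_lt hshape hshift hslow_pos hrate
      ⟨⟨u, 0, hn u⟩, hu.imp_left (mul_left_injective₀ hK.ne').ne⟩ hx,
    fun x hx => hY.measureReal_iSup_le_eq_zero (hx.le.trans_eq hp₀.symm), fun x hx => ?_,
    hY.integrable_iSup_and_integral_iSup_le hshape hshift ⟨p₀, hp₀⟩ hslow_pos hrate,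
    integrable_iSup_pi_erlang hτmax_pos hslow_pos, ?_⟩
  · rw [cdf_shiftedErlang hτmax_pos _ hslow_pos, max_eq_left (sub_nonneg.2 hx)]
  · rw [integral_iSup_pi_erlang hτmax_pos hslow_pos, Fintype.card_fin]

theorem theorem3 {Ω : Type*} [MeasurableSpace Ω] (P : Measure Ω) [IsProbabilityMeasure P]
    (k m : ℕ) (hk : 0 < k) (hm : 0 < m)
    {c : ℕ} (n τ : Fin c → ℕ) (hn : ∀ u, 0 < n u) (hτ : ∀ u, 0 < τ u)
    (lam s : Fin c → ℝ) (hlam : ∀ u, 0 < lam u)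
    (tm : ℝ) (htm : ∀ u, lam u * s u = tm)
    (slow : Fin c) (hslow : ∀ u, lam slow ≤ lam u)
    (X : (u : Fin c) → Fin (n u) → Fin (τ u) → Ω → ℝ)
    (hX : IsAdditiveServiceTime P k m n τ lam s X)
    (N τmax : ℕ) (hN : N = ∑ u, n u) (hτmax : IsGreatest (Set.range τ) τmax)
    (sm : ℝ) (hsm : IsGreatest (Set.range fun u => s u * (τ u : ℝ)) sm) :
    -- every worker's time is a shifted Erlang variable
    (∀ u i, P.map (workerTime X u i) =
      shiftedErlang (τ u) (τ u * s u / (k * m)) (lam u * (k * m))) ∧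
    -- the tail bound
    (∀ x : ℝ, sm / (k * m) ≤ x →
      P.real {ω | x < waitingTime X ω} ≤
        1 - (1 - ∑ j ∈ Finset.range τmax,
          Real.exp (lam slow * sm - lam slow * (k * m) * x) / (j.factorial : ℝ) *
            (lam slow * (k * m) * x - lam slow * sm) ^ j) ^ N) ∧
    -- the tail bound is strict beyond the shift unless all clusters behave alike
    ((∃ u, lam u ≠ lam slow ∨ τ u ≠ τmax) → ∀ x : ℝ, sm / (k * m) < x →
      P.real {ω | x < waitingTime X ω} <
        1 - (1 - ∑ j ∈ Finset.range τmax,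
          Real.exp (lam slow * sm - lam slow * (k * m) * x) / (j.factorial : ℝ) *
            (lam slow * (k * m) * x - lam slow * sm) ^ j) ^ N) ∧
    -- the distribution function vanishes below the shift
    (∀ x : ℝ, x < sm / (k * m) → P.real {ω | waitingTime X ω ≤ x} = 0) ∧
    -- the base of the power is the distribution function of a shifted Erlang law
    (∀ x : ℝ, sm / (k * m) ≤ x →
      cdf (shiftedErlang τmax (sm / (k * m)) (lam slow * (k * m))) x =
        1 - ∑ j ∈ Finset.range τmax,
          Real.exp (lam slow * sm - lam slow * (k * m) * x) / (j.factorial : ℝ) *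
            (lam slow * (k * m) * x - lam slow * sm) ^ j) ∧
    -- the bound on the mean
    (Integrable (waitingTime X) P ∧
      ∫ ω, waitingTime X ω ∂P ≤ sm / (k * m) + erlangMaxMean N τmax (lam slow * (k * m))) ∧
    -- `Φ` is the mean of the maximum of `N` independent Erlang variables
    (Integrable (fun y : Fin N → ℝ => ⨆ i, y i)
        (Measure.pi fun _ : Fin N => erlang τmax (lam slow * (k * m))) ∧
      ∫ y : Fin N → ℝ, (⨆ i, y i)
          ∂(Measure.pi fun _ : Fin N => erlang τmax (lam slow * (k * m))) =
        erlangMaxMean N τmax (lam slow * (k * m))) := by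
  exact theorem3_general P k m hk hm n τ hn hτ lam s hlam slow hslow X hX N τmax hN hτmax sm hsm
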